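/- \textbf{Corollary (Continuity for normal distributions).} For a real random variable $Y$ with law $P^Y$ and a random vector $\mathbf{Z}$, let $$\xi(Y,\mathbf{Z})=\frac{\int_{\mathbb R}\mathrm{Var}(P(Y\ge y\mid \mathbf{Z}))\,dP^{Y}(y)}{\int_{\mathbb R}\mathrm{Var}(\mathbf 1_{\{Y\ge y\}})\,dP^{Y}(y)}$$ denote Chatterjee's rank correlation, and for $\mathbf{Y}=(Y_1,\dots,Y_q)$ let $$T(\mathbf{Y},\mathbf{X})=1-\frac{q-\sum_{i=1}^q\xi(Y_i,(\mathbf{X},Y_{i-1},\dots,Y_1))}{q-\sum_{i=1}^q\xi(Y_i,(Y_{i-1},\dots,Y_1))},\qquad \xi(Y_1,\emptyset):=0 .$$ The Markov product of $(\mathbf{Z},Y)$ is the law of $(Y,Y')$, where $Y'$ is conditionally independent of $Y$ given $\mathbf{Z}$ and has the same conditional law given $\mathbf{Z}$ as $Y$. A sequence of functions $f_n\colon\mathbb{R}^d\to\mathbb{C}$ is asymptotically equicontinuous on an open set $V\subseteq\mathbb{R}^d$ if for all $\varepsilon>0$ and $x\in V$ there are $\delta>0$ and $N\in\mathbb{N}$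 such that $|f_n(x')-f_n(x)|<\varepsilon$ whenever $|x'-x|\le\delta$ and $n>N$. For a distribution function $F$ let $F^{-1}(t)=\inf\{x: F(x)\ge t\}$. Let $p,q\ge 1$, and let $(\mathbf{X}_n,\mathbf{Y}_n)\sim N(\boldsymbol\mu_n,\Sigma_n)$, $n\in\mathbb{N}$, and $(\mathbf{X},\mathbf{Y})\sim N(\boldsymbol\mu,\Sigma)$ be $(p+q)$-dimensional normally distributed random vectors with $\Sigma_n$, $n\in\mathbb{N}$, and $\Sigma$ positive definite. Write $\mathbf{Y}_n=(Y_{1,n},\dots,Y_{q,n})$ and $\mathbf{Y}=(Y_1,\dots,Y_q)$. Assume that $\Sigma_n\to\Sigma$. Then the following hold. \begin{enumerate} \item[(i)] If $\boldsymbol\mu_n\to\boldsymbol\mu$, then $(\mathbf{X}_n,\mathbf{Y}_n)\xrightarrow{d}(\mathbf{X},\mathbf{Y})$. \item[(ii)] Regular conditional distributions can be chosen such that, for every bounded continuous $u\colon\mathbb{R}\to\mathbb{C}$, the sequences $(\mathbb{E}[u(Y_{1,n})\mid\mathbf{X}_n=\mathbf{x}])_n$, $(\mathbb{E}[u(Y_{i,n})\mid(\mathbf{X}_n,Y_{1,n},\dots,Y_{i-1,n})=\mathbf{z}])_n$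 and $(\mathbb{E}[u(Y_{i,n})\mid(Y_{1,n},\dots,Y_{i-1,n})=\mathbf{y}])_n$, $i\in\{2,\dots,q\}$, are asymptotically equicontinuous on $V_1$, $V_i$ and $U_i$, respectively, for all open sets $V_1\subseteq\mathbb{R}^p$, $V_i\subseteq\mathbb{R}^{p+i-1}$, $U_i\subseteq\mathbb{R}^{i-1}$ with $P(\mathbf{X}\in V_1)=P((\mathbf{X},Y_1,\dots,Y_{i-1})\in V_i)=P((Y_1,\dots,Y_{i-1})\in U_i)=1$. \item[(iii)] If $\boldsymbol\mu_n\to\boldsymbol\mu$, then the Markov product of $(\mathbf{X}_n,Y_{1,n})$ converges weakly to that of $(\mathbf{X},Y_1)$ and, for all $i\in\{2,\dots,q\}$, the Markov products of $((\mathbf{X}_n,Y_{1,n},\dots,Y_{i-1,n}),Y_{i,n})$ and of $((Y_{1,n},\dots,Y_{i-1,n}),Y_{i,n})$ converge weakly to those of $((\mathbf{X},Y_1,\dots,Y_{i-1}),Y_i)$ and of $((Y_1,\dots,Y_{i-1}),Y_i)$. \item[(iv)] $F_{Y_{i,n}}\circ F_{Y_{i,n}}^{-1}(t)\to F_{Y_i}\circ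 F_{Y_i}^{-1}(t)$ for Lebesgue-almost all $t\in(0,1)$ and all $i\in\{1,\dots,q\}$. \end{enumerate} Moreover (with no assumption on the means), $T(\mathbf{Y}_n,\mathbf{X}_n)\to T(\mathbf{Y},\mathbf{X})$. -/

import Mathlib

open MeasureTheory ProbabilityTheory Filter Topology
open scoped BoundedContinuousFunction ENNReal

/-- Chatterjee's rank correlation `ξ(Y, Z)` of a real random variable `Y` and a random vector `Z`:
`∫ Var(P(Y ≥ y | Z)) dP^Y(y) / ∫ Var(1_{Y ≥ y}) dP^Y(y)`.
Here `P(Y ≥ y | Z)` is the conditional expectation of the indicator of `{Y ≥ y}` given the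
σ-algebra generated by `Z`. -/
noncomputable def chatterjeeXi {Ω E : Type*} [MeasurableSpace Ω] [mE : MeasurableSpace E]
    (P : Measure Ω) (Y : Ω → ℝ) (Z : Ω → E) : ℝ :=
  (∫ y, Var[P[{ω | y ≤ Y ω}.indicator (fun _ => (1 : ℝ)) | mE.comap Z]; P] ∂(P.map Y)) /
    (∫ y, Var[{ω | y ≤ Y ω}.indicator (fun _ => (1 : ℝ)); P] ∂(P.map Y))

/-- The vector of the components of `Y` before the `i`-th one, `(Y₁, …, Y_{i-1})` in one-based
notation; for the first index it is the empty vector. -/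
def before {Ω : Type*} {q : ℕ} (Y : Ω → Fin q → ℝ) (i : Fin q) : Ω → Fin (i : ℕ) → ℝ :=
  fun ω j => Y ω (Fin.castLE i.isLt.le j)

/-- The vector `(X, Y₁, …, Y_{i-1})`; for the first index it is `X` (with an empty second part). -/
def withBefore {Ω : Type*} {p q : ℕ} (X : Ω → Fin p → ℝ) (Y : Ω → Fin q → ℝ) (i : Fin q) :
    Ω → (Fin p → ℝ) × (Fin (i : ℕ) → ℝ) :=
  fun ω => (X ω, before Y i ω)

/-- The `i`-th component of the random vector `Y`. -/
def component {Ω : Type*} {q : ℕ} (Y : Ω → Fin q → ℝ) (i : Fin q) : Ω → ℝ :=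
  fun ω => Y ω i

theorem measurable_component {Ω : Type*} [MeasurableSpace Ω] {q : ℕ} {Y : Ω → Fin q → ℝ}
    (hY : Measurable Y) (i : Fin q) : Measurable (component Y i) :=
  (measurable_pi_apply i).comp hY

theorem measurable_before {Ω : Type*} [MeasurableSpace Ω] {q : ℕ} {Y : Ω → Fin q → ℝ}
    (hY : Measurable Y) (i : Fin q) : Measurable (before Y i) :=
  measurable_pi_lambda _ fun j => (measurable_pi_apply (Fin.castLE i.isLt.le j)).comp hY

theorem measurable_withBefore {Ω : Type*} [MeasurableSpace Ω] {p q : ℕ} {X : Ω → Fin p → ℝ}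
    {Y : Ω → Fin q → ℝ} (hX : Measurable X) (hY : Measurable Y) (i : Fin q) :
    Measurable (withBefore X Y i) :=
  hX.prodMk (measurable_before hY i)

/-- The multi-output dependence measure
`T(Y, X) = 1 - (q - ∑ ξ(Y_i, (X, Y_{i-1}, …, Y₁))) / (q - ∑ ξ(Y_i, (Y_{i-1}, …, Y₁)))`,
with `ξ(Y₁, ∅) = 0`. -/
noncomputable def dependenceT {Ω : Type*} [MeasurableSpace Ω] {p q : ℕ} (P : Measure Ω)
    (Y : Ω → Fin q → ℝ) (X : Ω → Fin p → ℝ) : ℝ :=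
  1 - ((q : ℝ) - ∑ i : Fin q, chatterjeeXi P (component Y i) (withBefore X Y i)) /
    ((q : ℝ) - ∑ i : Fin q,
      if (i : ℕ) = 0 then 0 else chatterjeeXi P (component Y i) (before Y i))

/-- The Markov product of `(Z, Y)`: the law of `(Y, Y')`, where `Y'` is a copy of `Y` that is
conditionally independent of `Y` given `Z` and has the same conditional law given `Z`. That is,
the measure `A × B ↦ ∫ P(Y ∈ A | Z = z) P(Y ∈ B | Z = z) dP^Z(z)`. -/
noncomputable def markovProduct {Ω E : Type*} [MeasurableSpace Ω] [MeasurableSpace E]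
    (P : Measure Ω) [IsProbabilityMeasure P] (Y : Ω → ℝ) (Z : Ω → E) (hZ : Measurable Z) :
    ProbabilityMeasure (ℝ × ℝ) :=
  ⟨(P.map Z).bind (condDistrib Y Z P ×ₖ condDistrib Y Z P), by
    have := Measure.isProbabilityMeasure_map (μ := P) hZ.aemeasurable
    infer_instance⟩

/-- Asymptotic equicontinuity on `V` of a sequence of functions. -/
def AsympEquicontinuousOn {E : Type*} [PseudoMetricSpace E] (f : ℕ → E → ℂ) (V : Set E) : Prop :=
  ∀ ε > 0, ∀ x ∈ V, ∃ δ > 0, ∃ N : ℕ, ∀ x', dist x' x ≤ δ → ∀ n > N, ‖f n x' - f n x‖ < ε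

/-- The functions `x ↦ E[u(Y_n) | Z_n = x]` are asymptotically equicontinuous on `V` for every
bounded continuous `u`. Conditional expectations given `Z_n = x` are determined for almost all `x`
only; they are taken with respect to regular conditional distributions `κ n` of `Y_n` given `Z_n`
that depend neither on `u` nor on the point. -/
def CondAsympEquicontinuousOn {E : Type*} [PseudoMetricSpace E] [MeasurableSpace E]
    {Ω : ℕ → Type*} [∀ n, MeasurableSpace (Ω n)] (P : ∀ n, Measure (Ω n))
    (Y : ∀ n, Ω n → ℝ) (Z : ∀ n, Ω n → E) (V : Set E) : Prop :=
  ∃ κ : ℕ → Kernel E ℝ,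
    (∀ n, IsMarkovKernel (κ n) ∧ HasCondDistrib (Y n) (Z n) (κ n) (P n)) ∧
      ∀ u : ℝ →ᵇ ℂ, AsympEquicontinuousOn (fun n x => ∫ y, u y ∂(κ n x)) V

/-- The generalized inverse `F⁻¹(t) = inf {x | F(x) ≥ t}` of a distribution function. -/
noncomputable def genInverse (F : ℝ → ℝ) (t : ℝ) : ℝ :=
  sInf {x | t ≤ F x}

/-- The joint random vector `(X, Y)` is `(p + q)`-variate normal with mean vector `μ` and
covariance matrix `S`. -/
def IsJointNormal {Ω : Type*} [MeasurableSpace Ω] {p q : ℕ} (P : Measure Ω)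
    (X : Ω → Fin p → ℝ) (Y : Ω → Fin q → ℝ) (μ : EuclideanSpace ℝ (Fin p ⊕ Fin q))
    (S : Matrix (Fin p ⊕ Fin q) (Fin p ⊕ Fin q) ℝ) : Prop :=
  HasLaw (fun ω => WithLp.toLp 2 (Sum.elim (X ω) (Y ω))) (multivariateGaussian μ S) P

open scoped NNReal Matrix

/-! ### One-dimensional normal distributions -/

/-- The standard normal distribution on `ℝ`. -/
noncomputable abbrev stdNormal : Measure ℝ := gaussianReal 0 1

theorem gaussianReal_eq_map_stdNormal (m : ℝ) (v : ℝ≥0) :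
    gaussianReal m v = stdNormal.map (fun x => m + √(v : ℝ) * x) := by
  have h : (fun x : ℝ => m + √(v : ℝ) * x) = (fun x => m + x) ∘ fun x => √(v : ℝ) * x := rfl
  rw [h, ← Measure.map_map (by fun_prop) (by fun_prop), gaussianReal_map_const_mul,
    gaussianReal_map_const_add]
  congr 1
  · simp
  · ext; simp

/-- The upper tail function of the standard normal distribution. -/
noncomputable def normalTail (t : ℝ) : ℝ := stdNormal.real (Set.Ici t)

theorem normalTail_nonneg (t : ℝ) : 0 ≤ normalTail t := measureReal_nonneg

theorem normalTail_le_one (t : ℝ) : normalTail t ≤ 1 := measureReal_le_one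

theorem continuous_cdf (ν : Measure ℝ) [IsProbabilityMeasure ν] [NullSingletonClass ν] :
    Continuous (cdf ν) := by
  refine continuous_iff_continuousAt.2 fun x => ?_
  have h := (cdf ν).measure_singleton x
  rw [measure_cdf, measure_singleton, eq_comm, ENNReal.ofReal_eq_zero] at h
  rw [(cdf ν).mono.continuousAt_iff_leftLim_eq_rightLim, (cdf ν).rightLim_eq]
  exact le_antisymm ((cdf ν).mono.leftLim_le le_rfl) (by linarith)

theorem cdf_genInverse (ν : Measure ℝ) [IsProbabilityMeasure ν] [NullSingletonClass ν] {t : ℝ}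
    (ht : t ∈ Set.Ioo (0 : ℝ) 1) : cdf ν (genInverse (cdf ν) t) = t := by
  have hc := continuous_cdf ν
  have hmono := monotone_cdf ν
  obtain ⟨a, ha⟩ := ((tendsto_cdf_atBot ν).eventually (gt_mem_nhds ht.1)).exists
  obtain ⟨b, hb⟩ := ((tendsto_cdf_atTop ν).eventually (lt_mem_nhds ht.2)).exists
  have hbdd : BddBelow {x | t ≤ cdf ν x} :=
    ⟨a, fun x (hx : t ≤ cdf ν x) => le_of_lt (hmono.reflect_lt (ha.trans_le hx))⟩
  have hne : {x | t ≤ cdf ν x}.Nonempty := ⟨b, hb.le⟩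
  have hclosed : IsClosed {x | t ≤ cdf ν x} := isClosed_le continuous_const hc
  refine le_antisymm ?_ (hclosed.csInf_mem hne hbdd)
  refine le_of_tendsto (hc.continuousAt.continuousWithinAt (s := Set.Iio (genInverse (cdf ν) t))).tendsto ?_
  filter_upwards [self_mem_nhdsWithin] with x hx
  exact le_of_lt (not_le.1 fun h => (notMem_of_lt_csInf hx hbdd) h)

instance nullSingletonClass_stdNormal : NullSingletonClass stdNormal :=
  nullSingletonClass_gaussianReal one_ne_zero

theorem normalTail_eq (t : ℝ) : normalTail t = 1 - cdf stdNormal t := by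
  rw [normalTail, cdf_eq_real, ← probReal_compl_eq_one_sub measurableSet_Iic, Set.compl_Iic,
    measureReal_congr Ioi_ae_eq_Ici]

@[fun_prop]
theorem continuous_normalTail : Continuous normalTail := by
  rw [funext normalTail_eq]
  exact continuous_const.sub (continuous_cdf _)

theorem gaussianReal_real_Ici (m : ℝ) {v : ℝ≥0} (hv : v ≠ 0) (y : ℝ) :
    (gaussianReal m v).real (Set.Ici y) = normalTail ((y - m) / √(v : ℝ)) := by
  have hs : 0 < √(v : ℝ) := Real.sqrt_pos.2 (by positivity)
  rw [gaussianReal_eq_map_stdNormal, map_measureReal_apply (by fun_prop) measurableSet_Ici,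
    normalTail]
  congr 1
  ext x
  simp only [Set.mem_preimage, Set.mem_Ici, div_le_iff₀ hs]
  constructor <;> intro h <;> linarith

/-- The `L¹` distance between the densities of the normal distributions with unit variance and
means `h` and `0`. -/
noncomputable def normalShift (h : ℝ) : ℝ :=
  ∫ x, |gaussianPDFReal 0 1 (x - h) - gaussianPDFReal 0 1 x|

theorem norm_integral_gaussianReal_sub_le (u : ℝ →ᵇ ℂ) (a a' : ℝ) {v : ℝ≥0} (hv : v ≠ 0) :
    ‖∫ y, u y ∂(gaussianReal a' v) - ∫ y, u y ∂(gaussianReal a v)‖ ≤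
      ‖u‖ * normalShift ((a' - a) / √(v : ℝ)) := by
  have hs : 0 < √(v : ℝ) := Real.sqrt_pos.2 (by positivity)
  set s := √(v : ℝ)
  set h := (a' - a) / s
  have hsh : s * h = a' - a := by simp only [h]; field_simp
  have key (b : ℝ) : ∫ y, u y ∂(gaussianReal b v) =
      ∫ x, gaussianPDFReal 0 1 x • u (b + s * x) := by
    rw [gaussianReal_eq_map_stdNormal, integral_map (by fun_prop)
      u.continuous.aestronglyMeasurable, integral_gaussianReal_eq_integral_smul one_ne_zero]
  have hshift : ∫ y, u y ∂(gaussianReal a' v) =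
      ∫ x, gaussianPDFReal 0 1 (x - h) • u (a + s * x) := by
    rw [key, ← integral_sub_right_eq_self _ h]
    congr 1 with x
    congr 2
    linear_combination -hsh
  have hint (g : ℝ → ℝ) (hg : Integrable g) : Integrable fun x => g x • u (a + s * x) := by
    refine Integrable.smul_of_top_left hg ?_
    exact memLp_top_of_bound (by fun_prop) ‖u‖ (.of_forall fun x => u.norm_coe_le_norm _)
  have hφ : Integrable (gaussianPDFReal 0 1) := integrable_gaussianPDFReal 0 1
  have hφ' : Integrable fun x => gaussianPDFReal 0 1 (x - h) := hφ.comp_sub_right h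
  rw [hshift, key, ← integral_sub (hint _ hφ') (hint _ hφ), normalShift,
    ← integral_const_mul]
  refine norm_integral_le_of_norm_le ((hφ'.sub hφ).abs.const_mul _) (.of_forall fun x => ?_)
  rw [← sub_smul, norm_smul, Real.norm_eq_abs, mul_comm]
  exact mul_le_mul_of_nonneg_right (u.norm_coe_le_norm _) (abs_nonneg _)

theorem tendsto_normalShift : Tendsto normalShift (𝓝 0) (𝓝 0) := by
  have hc : Continuous (gaussianPDFReal 0 1) := by unfold gaussianPDFReal; fun_prop
  have h0 : normalShift 0 = 0 := by simp [normalShift]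
  have hφ : Integrable (gaussianPDFReal 0 1) := integrable_gaussianPDFReal 0 1
  have hexp : Integrable fun x : ℝ =>
      (√(2 * Real.pi * (1 : ℝ≥0)))⁻¹ * (Real.exp (1 / 2) * Real.exp (-(1 / 4) * x ^ 2)) :=
    ((integrable_exp_neg_mul_sq (by norm_num)).const_mul _).const_mul _
  nth_rw 2 [← h0]
  refine tendsto_integral_filter_of_dominated_convergence
    (fun x => (√(2 * Real.pi * (1 : ℝ≥0)))⁻¹ * (Real.exp (1 / 2) * Real.exp (-(1 / 4) * x ^ 2)) +
      gaussianPDFReal 0 1 x) (.of_forall fun h => ?_) ?_ (hexp.add hφ) (.of_forall fun x => ?_)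
  · exact Continuous.aestronglyMeasurable (by fun_prop)
  · filter_upwards [Metric.ball_mem_nhds (0 : ℝ) one_pos] with h hh
    have hh1 : h ^ 2 ≤ 1 := by
      rw [Metric.mem_ball, dist_zero_right, Real.norm_eq_abs] at hh
      exact (sq_le_one_iff_abs_le_one h).2 hh.le
    refine .of_forall fun x => ?_
    rw [Real.norm_eq_abs, abs_abs]
    refine (abs_sub _ _).trans (add_le_add ?_ ?_)
    · rw [abs_of_nonneg (gaussianPDFReal_nonneg _ _ _), gaussianPDFReal, ← Real.exp_add]
      gcongr
      simp only [NNReal.coe_one]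
      nlinarith [sq_nonneg (x - 2 * h)]
    · rw [abs_of_nonneg (gaussianPDFReal_nonneg _ _ _)]
  · exact Continuous.tendsto (f := fun h => |gaussianPDFReal 0 1 (x - h) - gaussianPDFReal 0 1 x|)
      (by fun_prop) 0

/-! ### Conditionally normal random variables -/

/-- The Markov kernel `z ↦ N(ℓ z, v)`. -/
noncomputable def normalKernel {E : Type*} [MeasurableSpace E] (ℓ : E → ℝ) (hℓ : Measurable ℓ)
    (v : ℝ≥0) : Kernel E ℝ where
  toFun z := gaussianReal (ℓ z) v
  measurable' := measurable_gaussianReal.comp (hℓ.prodMk measurable_const)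

theorem normalKernel_apply {E : Type*} [MeasurableSpace E] (ℓ : E → ℝ) (hℓ : Measurable ℓ)
    (v : ℝ≥0) (z : E) : normalKernel ℓ hℓ v z = gaussianReal (ℓ z) v := rfl

instance isMarkovKernel_normalKernel {E : Type*} [MeasurableSpace E] (ℓ : E → ℝ)
    (hℓ : Measurable ℓ) (v : ℝ≥0) : IsMarkovKernel (normalKernel ℓ hℓ v) :=
  ⟨fun z => by rw [normalKernel_apply]; infer_instance⟩

/-- Given `Z`, the random variable `Y` is normal with mean `ℓ(Z)` and variance `v`, where the
regression function `ℓ(Z)` is itself normal with mean `m` and variance `r`. -/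
structure IsNormalRegression {Ω E : Type*} [MeasurableSpace Ω] [MeasurableSpace E] (P : Measure Ω)
    (Y : Ω → ℝ) (Z : Ω → E) (ℓ : E → ℝ) (m : ℝ) (r v : ℝ≥0) : Prop where
  measurable_mean : Measurable ℓ
  hasCondDistrib : HasCondDistrib Y Z (normalKernel ℓ measurable_mean v) P
  map_mean : P.map (fun ω => ℓ (Z ω)) = gaussianReal m r
  map_target : P.map Y = gaussianReal m (r + v)

/-- Chatterjee's rank correlation of a normal random variable with explained variance `r` and
residual variance `v`. -/
noncomputable def normalXi (r v : ℝ≥0) : ℝ :=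
  (∫ η, Var[fun x => normalTail ((√((r + v : ℝ≥0) : ℝ) * η - √(r : ℝ) * x) / √(v : ℝ)); stdNormal]
      ∂stdNormal) /
    (∫ η, Var[(Set.Ici η).indicator (fun _ => (1 : ℝ)); stdNormal] ∂stdNormal)

section

variable {Ω E : Type*} [MeasurableSpace Ω] [mE : MeasurableSpace E] {P : Measure Ω}
  [IsProbabilityMeasure P] {Y : Ω → ℝ} {Z : Ω → E} {ℓ : E → ℝ} {m : ℝ} {r v : ℝ≥0}

theorem IsNormalRegression.condDistrib_ae_eq (h : IsNormalRegression P Y Z ℓ m r v) :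
    condDistrib Y Z P =ᵐ[P.map Z] normalKernel ℓ h.measurable_mean v :=
  condDistrib_ae_eq_of_measure_eq_compProd Z h.hasCondDistrib.aemeasurable_snd
    h.hasCondDistrib.map_eq

theorem IsNormalRegression.condExp_ae_eq (h : IsNormalRegression P Y Z ℓ m r v)
    (hY : Measurable Y) (hZ : Measurable Z) (hv : v ≠ 0) (y : ℝ) :
    P[{ω | y ≤ Y ω}.indicator (fun _ => (1 : ℝ)) | mE.comap Z] =ᵐ[P]
      fun ω => normalTail ((y - ℓ (Z ω)) / √(v : ℝ)) := by
  have h1 := condDistrib_ae_eq_condExp (μ := P) hZ hY (measurableSet_Ici (a := y))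
  have h2 := ae_of_ae_map hZ.aemeasurable h.condDistrib_ae_eq
  filter_upwards [h1, h2] with ω h1 h2
  rw [h2, normalKernel_apply, gaussianReal_real_Ici _ hv] at h1
  exact h1.symm

theorem IsNormalRegression.chatterjeeXi_eq (h : IsNormalRegression P Y Z ℓ m r v)
    (hY : Measurable Y) (hZ : Measurable Z) (hv : v ≠ 0) :
    chatterjeeXi P Y Z = normalXi r v := by
  have hs : 0 < √((r + v : ℝ≥0) : ℝ) := Real.sqrt_pos.2 (by positivity)
  have hfst (y : ℝ) :
      Var[P[{ω | y ≤ Y ω}.indicator (fun _ => (1 : ℝ)) | mE.comap Z]; P] =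
        Var[fun x => normalTail ((y - (m + √(r : ℝ) * x)) / √(v : ℝ)); stdNormal] := by
    have hmeas : Measurable fun w : ℝ => normalTail ((y - w) / √(v : ℝ)) := by fun_prop
    rw [variance_congr (h.condExp_ae_eq hY hZ hv y),
      show (fun ω => normalTail ((y - ℓ (Z ω)) / √(v : ℝ))) =
        (fun w => normalTail ((y - w) / √(v : ℝ))) ∘ fun ω => ℓ (Z ω) from rfl,
      ← variance_map (Y := fun ω => ℓ (Z ω)) hmeas.aemeasurable
        (h.measurable_mean.comp hZ).aemeasurable, h.map_mean,
      gaussianReal_eq_map_stdNormal, variance_map hmeas.aemeasurable (by fun_prop)]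
    rfl
  have hsnd (y : ℝ) : Var[{ω | y ≤ Y ω}.indicator (fun _ => (1 : ℝ)); P] =
      Var[{x | y ≤ m + √((r + v : ℝ≥0) : ℝ) * x}.indicator (fun _ => (1 : ℝ)); stdNormal] := by
    have hmeas : Measurable ((Set.Ici y).indicator (fun _ => (1 : ℝ))) :=
      measurable_const.indicator measurableSet_Ici
    rw [show {ω | y ≤ Y ω}.indicator (fun _ => (1 : ℝ)) =
        (Set.Ici y).indicator (fun _ => (1 : ℝ)) ∘ Y from rfl,
      ← variance_map hmeas.aemeasurable hY.aemeasurable, h.map_target,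
      gaussianReal_eq_map_stdNormal, variance_map hmeas.aemeasurable (by fun_prop)]
    rfl
  have hemb : MeasurableEmbedding fun x : ℝ => m + √((r + v : ℝ≥0) : ℝ) * x :=
    ((Homeomorph.mulLeft₀ _ hs.ne').trans (Homeomorph.addLeft m)).measurableEmbedding
  simp_rw [chatterjeeXi, hfst, hsnd, h.map_target]
  rw [gaussianReal_eq_map_stdNormal m (r + v), hemb.integral_map, hemb.integral_map, normalXi]
  congr 1
  · congr 1 with η
    congr 1 with x
    congr 2
    ring
  · congr 1 with η
    congr 2
    ext x
    rw [Set.mem_ofPred_eq, add_le_add_iff_left, mul_le_mul_iff_right₀ hs, Set.mem_Ici]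

theorem chatterjeeXi_le_one (P : Measure Ω) [IsProbabilityMeasure P] (hY : Measurable Y)
    (hZ : Measurable Z) : chatterjeeXi P Y Z ≤ 1 := by
  have hind (y : ℝ) : MemLp ({ω | y ≤ Y ω}.indicator (fun _ => (1 : ℝ))) 2 P :=
    memLp_indicator_const 2 (hY measurableSet_Ici) 1 (.inr (measure_ne_top _ _))
  have hvar (y : ℝ) : Var[{ω | y ≤ Y ω}.indicator (fun _ => (1 : ℝ)); P] =
      P.real {ω | y ≤ Y ω} - P.real {ω | y ≤ Y ω} ^ 2 := by
    have hsq : ({ω | y ≤ Y ω}.indicator (fun _ => (1 : ℝ))) ^ 2 =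
        {ω | y ≤ Y ω}.indicator (fun _ => (1 : ℝ)) := by
      ext ω
      by_cases hω : y ≤ Y ω <;> simp [hω]
    have hint : ∫ ω, {ω | y ≤ Y ω}.indicator (fun _ => (1 : ℝ)) ω ∂P = P.real {ω | y ≤ Y ω} :=
      integral_indicator_one (hY measurableSet_Ici)
    rw [variance_eq_sub (hind y), hsq, hint]
  have hanti : Antitone fun y => P.real {ω | y ≤ Y ω} := fun a b hab =>
    measureReal_mono fun ω (hω : b ≤ Y ω) => hab.trans hω
  have hYP : IsProbabilityMeasure (P.map Y) := Measure.isProbabilityMeasure_map hY.aemeasurable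
  refine div_le_one_of_le₀ (integral_mono_of_nonneg (.of_forall fun y => variance_nonneg _ _) ?_
    (.of_forall fun y => ?_)) (integral_nonneg fun y => variance_nonneg _ _)
  · simp_rw [hvar]
    refine Integrable.of_bound
      (hanti.measurable.sub (hanti.measurable.pow_const 2)).aestronglyMeasurable 1
      (.of_forall fun y => ?_)
    have h0 : 0 ≤ P.real {ω | y ≤ Y ω} := measureReal_nonneg
    have h1 : P.real {ω | y ≤ Y ω} ≤ 1 := measureReal_le_one
    rw [Real.norm_eq_abs, abs_le]
    constructor <;> nlinarith
  · have := integral_condVar_add_variance_condExp hZ.comap_le (hind y)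
    have h0 : 0 ≤ ∫ ω, (Var[{ω | y ≤ Y ω}.indicator (fun _ => (1 : ℝ)); P | mE.comap Z]) ω ∂P :=
      integral_nonneg_of_ae (condExp_nonneg (.of_forall fun ω => sq_nonneg _))
    simp only
    linarith

theorem continuousAt_integral_variance {A : Type*} [TopologicalSpace A]
    [FirstCountableTopology A] (ν : Measure ℝ) [IsProbabilityMeasure ν] {T : A → ℝ → ℝ → ℝ} {a : A}
    (hmeas : ∀ p, Measurable fun y : ℝ × ℝ => T p y.1 y.2)
    (hbound : ∀ p η x, T p η x ∈ Set.Icc (0 : ℝ) 1)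
    (hcont : ∀ η x, ContinuousAt (fun p => T p η x) a) :
    ContinuousAt (fun p => ∫ η, Var[T p η; ν] ∂ν) a := by
  have hmeas' (p η) : Measurable (T p η) := (hmeas p).comp measurable_prodMk_left
  have hvar (p η) : Var[T p η; ν] = ∫ x, T p η x ^ 2 ∂ν - (∫ x, T p η x ∂ν) ^ 2 := by
    refine variance_eq_sub (MemLp.of_bound (hmeas' p η).aestronglyMeasurable 1
      (.of_forall fun x => ?_))
    rw [Real.norm_eq_abs, abs_of_nonneg (hbound p η x).1]
    exact (hbound p η x).2
  refine continuousAt_of_dominated (bound := fun _ => ((1 - 0) / 2) ^ 2) (.of_forall fun p => ?_)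
    (.of_forall fun p => .of_forall fun η => ?_) (integrable_const _) (.of_forall fun η => ?_)
  · simp_rw [hvar]
    exact ((((hmeas p).pow_const 2).stronglyMeasurable.integral_prod_right').sub
      ((hmeas p).stronglyMeasurable.integral_prod_right'.pow 2)).aestronglyMeasurable
  · rw [Real.norm_eq_abs, abs_of_nonneg (variance_nonneg _ _)]
    exact variance_le_sq_of_bounded (.of_forall (hbound p η)) (hmeas' p η).aemeasurable
  · simp_rw [hvar]
    refine ContinuousAt.sub ?_ (ContinuousAt.pow ?_ 2)
    · refine continuousAt_of_dominated (bound := fun _ => 1)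
        (.of_forall fun p => ((hmeas' p η).pow_const 2).aestronglyMeasurable)
        (.of_forall fun p => .of_forall fun x => ?_) (integrable_const _)
        (.of_forall fun x => (hcont η x).pow 2)
      rw [Real.norm_eq_abs, abs_of_nonneg (sq_nonneg _)]
      exact pow_le_one₀ (hbound p η x).1 (hbound p η x).2
    · refine continuousAt_of_dominated (bound := fun _ => 1)
        (.of_forall fun p => (hmeas' p η).aestronglyMeasurable)
        (.of_forall fun p => .of_forall fun x => ?_) (integrable_const _)
        (.of_forall fun x => hcont η x)
      rw [Real.norm_eq_abs, abs_of_nonneg (hbound p η x).1]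
      exact (hbound p η x).2

theorem continuousAt_normalXi {r v : ℝ≥0} (hv : v ≠ 0) :
    ContinuousAt (fun p : ℝ≥0 × ℝ≥0 => normalXi p.1 p.2) (r, v) := by
  have hs : √(v : ℝ) ≠ 0 := (Real.sqrt_pos.2 (by positivity)).ne'
  refine ContinuousAt.div_const (continuousAt_integral_variance stdNormal
    (T := fun (p : ℝ≥0 × ℝ≥0) η x =>
      normalTail ((√((p.1 + p.2 : ℝ≥0) : ℝ) * η - √(p.1 : ℝ) * x) / √(p.2 : ℝ)))
    (fun p => by fun_prop) (fun p η x => ⟨normalTail_nonneg _, normalTail_le_one _⟩)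
    fun η x => continuous_normalTail.continuousAt.comp (ContinuousAt.div ?_ ?_ hs)) _ <;>
  exact Continuous.continuousAt (by fun_prop)

theorem IsNormalRegression.markovProduct_eq (h : IsNormalRegression P Y Z ℓ m r v)
    (hZ : Measurable Z) :
    (markovProduct P Y Z hZ : Measure (ℝ × ℝ)) =
      (stdNormal.prod (stdNormal.prod stdNormal)).map (fun x =>
        (m + √(r : ℝ) * x.1 + √(v : ℝ) * x.2.1, m + √(r : ℝ) * x.1 + √(v : ℝ) * x.2.2)) := by
  have hbind : (markovProduct P Y Z hZ : Measure (ℝ × ℝ)) =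
      (P.map Z).bind (normalKernel ℓ h.measurable_mean v ×ₖ normalKernel ℓ h.measurable_mean v) := by
    change (P.map Z).bind _ = _
    refine Measure.bind_congr_right ?_
    filter_upwards [h.condDistrib_ae_eq] with z hz
    rw [Kernel.prod_apply, Kernel.prod_apply, hz]
  rw [hbind]
  refine Measure.ext_of_lintegral _ fun f hf => ?_
  have hmap : ∀ w, (gaussianReal w v).prod (gaussianReal w v) =
      (stdNormal.prod stdNormal).map (fun x => (w + √(v : ℝ) * x.1, w + √(v : ℝ) * x.2)) := by
    intro w
    conv_lhs => rw [gaussianReal_eq_map_stdNormal]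
    rw [Measure.map_prod_map _ _ (by fun_prop) (by fun_prop)]
    rfl
  have hmeas : Measurable fun w => ∫⁻ x, f (w + √(v : ℝ) * x.1, w + √(v : ℝ) * x.2)
      ∂(stdNormal.prod stdNormal) :=
    Measurable.lintegral_prod_right' (f := fun p : ℝ × ℝ × ℝ =>
      f (p.1 + √(v : ℝ) * p.2.1, p.1 + √(v : ℝ) * p.2.2)) (by fun_prop)
  rw [Measure.lintegral_bind (Kernel.aemeasurable _) hf.aemeasurable, lintegral_map hf (by fun_prop),
    lintegral_prod _ (by fun_prop)]
  simp_rw [Kernel.prod_apply, normalKernel_apply, hmap]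
  have hinner (w : ℝ) : ∫⁻ y, f y ∂((stdNormal.prod stdNormal).map
      fun x => (w + √(v : ℝ) * x.1, w + √(v : ℝ) * x.2)) =
      ∫⁻ x, f (w + √(v : ℝ) * x.1, w + √(v : ℝ) * x.2) ∂(stdNormal.prod stdNormal) :=
    lintegral_map hf (by fun_prop)
  simp_rw [hinner]
  have hcomp : (P.map Z).map ℓ = gaussianReal m r := by
    rw [Measure.map_map h.measurable_mean hZ]
    exact h.map_mean
  rw [← lintegral_map hmeas h.measurable_mean, hcomp, gaussianReal_eq_map_stdNormal, lintegral_map hmeas (by fun_prop)]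

theorem tendsto_markovProduct {Ω : ℕ → Type*} [∀ n, MeasurableSpace (Ω n)] {P : ∀ n, Measure (Ω n)}
    [∀ n, IsProbabilityMeasure (P n)] {Ω' : Type*} [MeasurableSpace Ω'] {P' : Measure Ω'}
    [IsProbabilityMeasure P'] {Y : ∀ n, Ω n → ℝ} {Z : ∀ n, Ω n → E} {Y' : Ω' → ℝ} {Z' : Ω' → E}
    (hZ : ∀ n, Measurable (Z n)) (hZ' : Measurable Z')
    {ℓ : ℕ → E → ℝ} {m : ℕ → ℝ} {r v : ℕ → ℝ≥0} {ℓ' : E → ℝ} {m' : ℝ} {r' v' : ℝ≥0}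
    (h : ∀ n, IsNormalRegression (P n) (Y n) (Z n) (ℓ n) (m n) (r n) (v n))
    (h' : IsNormalRegression P' Y' Z' ℓ' m' r' v')
    (hm : Tendsto m atTop (𝓝 m')) (hr : Tendsto r atTop (𝓝 r')) (hv : Tendsto v atTop (𝓝 v')) :
    Tendsto (fun n => markovProduct (P n) (Y n) (Z n) (hZ n)) atTop
      (𝓝 (markovProduct P' Y' Z' hZ')) := by
  rw [ProbabilityMeasure.tendsto_iff_forall_integral_tendsto]
  intro f
  rw [h'.markovProduct_eq]
  simp_rw [fun n => (h n).markovProduct_eq (hZ n)]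
  simp_rw [fun (m : ℝ) (r v : ℝ≥0) => integral_map
    (μ := stdNormal.prod (stdNormal.prod stdNormal))
    (φ := fun x => (m + √(r : ℝ) * x.1 + √(v : ℝ) * x.2.1, m + √(r : ℝ) * x.1 + √(v : ℝ) * x.2.2))
    (by fun_prop) f.continuous.aestronglyMeasurable]
  refine tendsto_integral_of_dominated_convergence (fun _ => ‖f‖) (fun n => ?_)
    (integrable_const _) (fun n => .of_forall fun x => f.norm_coe_le_norm _)
    (.of_forall fun x => ?_)
  · exact Continuous.aestronglyMeasurable (by fun_prop)
  · have hr' : Tendsto (fun n => √(r n : ℝ)) atTop (𝓝 √(r' : ℝ)) :=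
      (NNReal.tendsto_coe.2 hr).sqrt
    have hv' : Tendsto (fun n => √(v n : ℝ)) atTop (𝓝 √(v' : ℝ)) :=
      (NNReal.tendsto_coe.2 hv).sqrt
    exact (f.continuous.tendsto _).comp
      (((hm.add (hr'.mul_const _)).add (hv'.mul_const _)).prodMk_nhds
        ((hm.add (hr'.mul_const _)).add (hv'.mul_const _)))

theorem condAsympEquicontinuousOn_of_isNormalRegression {E : Type*} [PseudoMetricSpace E]
    [MeasurableSpace E] {Ω : ℕ → Type*} [∀ n, MeasurableSpace (Ω n)] {P : ∀ n, Measure (Ω n)}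
    {Y : ∀ n, Ω n → ℝ} {Z : ∀ n, Ω n → E}
    {ℓ : ℕ → E → ℝ} {m : ℕ → ℝ} {r v : ℕ → ℝ≥0} {v' : ℝ≥0}
    (h : ∀ n, IsNormalRegression (P n) (Y n) (Z n) (ℓ n) (m n) (r n) (v n))
    (hv : Tendsto v atTop (𝓝 v')) (hv' : v' ≠ 0) {K : ℝ}
    (hℓ : ∀ᶠ n in atTop, ∀ x x', |ℓ n x' - ℓ n x| ≤ K * dist x' x) (V : Set E) :
    CondAsympEquicontinuousOn P Y Z V := by
  refine ⟨fun n => normalKernel (ℓ n) (h n).measurable_mean (v n),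
    fun n => ⟨inferInstance, (h n).hasCondDistrib⟩, fun u ε hε x _ => ?_⟩
  have hv'' : 0 < v' / 2 := by positivity
  set c : ℝ := √((v' / 2 : ℝ≥0) : ℝ)
  have hc : 0 < c := Real.sqrt_pos.2 (by positivity)
  have hlim : Tendsto (fun t => ‖u‖ * normalShift t) (𝓝 0) (𝓝 0) := by
    simpa using tendsto_normalShift.const_mul ‖u‖
  obtain ⟨η, hη, hηε⟩ := Metric.eventually_nhds_iff.1 (hlim.eventually_lt_const hε)
  have hδ : 0 < η * c / (|K| + 1) := by positivity
  obtain ⟨N, hN⟩ := eventually_atTop.1 (hℓ.and (hv.eventually_const_lt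
    (NNReal.half_lt_self hv')))
  refine ⟨_, hδ, N, fun x' hx' n hn => ?_⟩
  obtain ⟨hℓn, hvn⟩ := hN n hn.le
  have hvn0 : v n ≠ 0 := (hv''.trans hvn).ne'
  have hcn : c ≤ √(v n : ℝ) := Real.sqrt_le_sqrt (by exact_mod_cast hvn.le)
  refine (norm_integral_gaussianReal_sub_le u (ℓ n x) (ℓ n x') hvn0).trans_lt (hηε ?_)
  rw [dist_zero_right, Real.norm_eq_abs, abs_div, abs_of_pos (hc.trans_le hcn),
    div_lt_iff₀ (hc.trans_le hcn)]
  calc |ℓ n x' - ℓ n x| ≤ K * dist x' x := hℓn x x'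
    _ ≤ |K| * (η * c / (|K| + 1)) :=
      mul_le_mul (le_abs_self K) hx' dist_nonneg (abs_nonneg K)
    _ < (|K| + 1) * (η * c / (|K| + 1)) := by linarith
    _ = η * c := by field_simp
    _ ≤ η * √(v n : ℝ) := by gcongr

end

/-! ### Linear regression in the multivariate normal distribution -/

section

variable {J ι : Type*} [Fintype ι] [DecidableEq ι]

/-- The coefficients of the linear regression of the `k`-th coordinate on the coordinates `e j`
of a random vector with covariance matrix `S`. -/
noncomputable def regressionCoeff (S : Matrix J J ℝ) (e : ι → J) (k : J) : ι → ℝ :=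
  (S.submatrix e e)⁻¹ *ᵥ fun j => S (e j) k

/-- The part of the variance of the `k`-th coordinate that is explained by the coordinates `e j`. -/
noncomputable def explainedVariance (S : Matrix J J ℝ) (e : ι → J) (k : J) : ℝ :=
  regressionCoeff S e k ⬝ᵥ fun j => S (e j) k

variable {S : Matrix J J ℝ} {e : ι → J} {k : J}

theorem submatrix_mulVec_regressionCoeff (hS : S.PosDef) (he : e.Injective) :
    S.submatrix e e *ᵥ regressionCoeff S e k = fun j => S (e j) k := by
  have hdet : IsUnit (S.submatrix e e).det :=
    (Matrix.isUnit_iff_isUnit_det _).1 (hS.submatrix he).isUnit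
  rw [regressionCoeff, Matrix.mulVec_mulVec, Matrix.mul_nonsing_inv _ hdet, Matrix.one_mulVec]

theorem explainedVariance_nonneg (hS : S.PosDef) (he : e.Injective) :
    0 ≤ explainedVariance S e k := by
  have := (hS.submatrix he).posSemidef.dotProduct_mulVec_nonneg (regressionCoeff S e k)
  rwa [submatrix_mulVec_regressionCoeff hS he, star_trivial] at this

theorem explainedVariance_lt (hS : S.PosDef) (he : e.Injective) (hk : k ∉ Set.range e) :
    explainedVariance S e k < S k k := by
  set b := regressionCoeff S e k with hb
  have hinj : (Sum.elim e fun _ : Unit => k).Injective :=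
    he.sumElim (Function.injective_of_subsingleton _) fun a _ h => hk ⟨a, h⟩
  have hx : (Sum.elim (-b) fun _ : Unit => (1 : ℝ)) ≠ 0 := fun h => by
    simpa using congrFun h (Sum.inr ())
  have hpos := (hS.submatrix hinj).dotProduct_mulVec_pos hx
  have hblock : S.submatrix (Sum.elim e fun _ : Unit => k) (Sum.elim e fun _ : Unit => k) =
      Matrix.fromBlocks (S.submatrix e e) (S.submatrix e fun _ => k)
        (S.submatrix (fun _ => k) e) (S.submatrix (fun _ => k) fun _ => k) := by
    ext (i | i) (j | j) <;> rfl
  have hsymm (j : ι) : S k (e j) = S (e j) k := by simpa using hS.isHermitian.apply (e j) k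
  have h1 : (S.submatrix e fun _ : Unit => k) *ᵥ (fun _ => (1 : ℝ)) = fun j => S (e j) k := by
    ext j; simp [Matrix.mulVec, dotProduct]
  have h2 : (S.submatrix (fun _ : Unit => k) e) *ᵥ b = fun _ => explainedVariance S e k := by
    ext j; simp [Matrix.mulVec, dotProduct, explainedVariance, hsymm, ← hb, mul_comm]
  have h3 : (S.submatrix (fun _ : Unit => k) fun _ : Unit => k) *ᵥ (fun _ => (1 : ℝ)) =
      fun _ => S k k := by
    ext j; simp [Matrix.mulVec, dotProduct]
  rw [star_trivial, hblock, Matrix.fromBlocks_mulVec, Sum.elim_comp_inl, Sum.elim_comp_inr,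
    Matrix.mulVec_neg, Matrix.mulVec_neg, submatrix_mulVec_regressionCoeff hS he, h1, h2, h3,
    neg_add_cancel, sumElim_dotProduct_sumElim] at hpos
  simpa [dotProduct] using hpos

theorem tendsto_regressionCoeff {S : ℕ → Matrix J J ℝ} {S' : Matrix J J ℝ}
    (hS' : S'.PosDef) (he : e.Injective) (h : Tendsto S atTop (𝓝 S')) :
    Tendsto (fun n => regressionCoeff (S n) e k) atTop (𝓝 (regressionCoeff S' e k)) := by
  have hsub : Tendsto (fun n => (S n).submatrix e e) atTop (𝓝 (S'.submatrix e e)) :=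
    tendsto_pi_nhds.2 fun i => tendsto_pi_nhds.2 fun j => (h.apply_nhds (e i)).apply_nhds (e j)
  have hinv : Tendsto (fun n => ((S n).submatrix e e)⁻¹) atTop (𝓝 (S'.submatrix e e)⁻¹) :=
    (continuousAt_matrix_inv _ (by
      rw [Ring.inverse_eq_inv']
      exact continuousAt_inv₀ (hS'.submatrix he).det_pos.ne')).tendsto.comp hsub
  refine tendsto_pi_nhds.2 fun i => tendsto_finsetSum _ fun j _ => ?_
  exact ((hinv.apply_nhds i).apply_nhds j).mul ((h.apply_nhds (e j)).apply_nhds k)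

theorem tendsto_explainedVariance {S : ℕ → Matrix J J ℝ} {S' : Matrix J J ℝ}
    (hS' : S'.PosDef) (he : e.Injective) (h : Tendsto S atTop (𝓝 S')) :
    Tendsto (fun n => explainedVariance (S n) e k) atTop (𝓝 (explainedVariance S' e k)) := by
  refine tendsto_finsetSum _ fun j _ => ?_
  exact ((tendsto_regressionCoeff hS' he h).apply_nhds j).mul
    ((h.apply_nhds (e j)).apply_nhds k)

/-- The regression function of the `k`-th coordinate on the coordinates `e j` of a random vector
with mean `μ` and covariance matrix `S`. -/
noncomputable def regressionFun (μ : EuclideanSpace ℝ J) (S : Matrix J J ℝ) (e : ι → J) (k : J)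
    (z : ι → ℝ) : ℝ :=
  (μ k - ∑ j, regressionCoeff S e k j * μ (e j)) + ∑ j, regressionCoeff S e k j * z j

theorem isNormalRegression_of_hasLaw [Fintype J] [DecidableEq J] {Ω : Type*} [MeasurableSpace Ω] {P : Measure Ω}
    [IsProbabilityMeasure P] {μ : EuclideanSpace ℝ J} {U : Ω → EuclideanSpace ℝ J}
    (hU : HasLaw U (multivariateGaussian μ S) P)
    (hS : S.PosDef) (he : e.Injective) (hk : k ∉ Set.range e) :
    IsNormalRegression P (fun ω => U ω k) (fun ω j => U ω (e j)) (regressionFun μ S e k) (μ k)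
      (explainedVariance S e k).toNNReal (S k k - explainedVariance S e k).toNNReal := by
  set b := regressionCoeff S e k with hb
  have hUm := hU.aemeasurable
  have hUg : HasGaussianLaw U P := hU.hasGaussianLaw
  have hcoord (i : J) : HasGaussianLaw (fun ω => U ω i) P := hUg.map_fun (EuclideanSpace.proj i)
  have hcov (i j : J) : cov[fun ω => U ω i, fun ω => U ω j; P] = S i j := by
    rw [← covariance_eval_multivariateGaussian (μ := μ) hS.posSemidef i j, ← hU.map_eq,
      covariance_map (by fun_prop) (by fun_prop) hUm]
    rfl
  have hmean (i : J) : ∫ ω, U ω i ∂P = μ i := by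
    have hid : ∫ x, x i ∂(multivariateGaussian μ S) = μ i := by
      simpa using (EuclideanSpace.proj (𝕜 := ℝ) i).integral_comp_comm
        (IsGaussian.integrable_fun_id (μ := multivariateGaussian μ S))
    rw [← hid, ← hU.map_eq, integral_map hUm (by fun_prop)]
  set W : Ω → ℝ := fun ω => ∑ j, b j * U ω (e j) with hW
  set R : Ω → ℝ := fun ω => U ω k - W ω with hR
  have hWg : HasGaussianLaw W P := by
    have := hUg.map_fun (∑ j, b j • EuclideanSpace.proj (𝕜 := ℝ) (e j))
    simpa [hW] using this
  have hpair : HasGaussianLaw (fun ω => (fun j => U ω (e j), fun _ : Unit => R ω)) P := by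
    have := hUg.map_fun ((ContinuousLinearMap.pi fun j =>
      EuclideanSpace.proj (𝕜 := ℝ) (e j)).prod
        (ContinuousLinearMap.pi fun _ : Unit => EuclideanSpace.proj (𝕜 := ℝ) k -
          ∑ j, b j • EuclideanSpace.proj (𝕜 := ℝ) (e j)))
    simpa [hW, hR] using this
  have hRg : HasGaussianLaw R P := hpair.snd.eval ()
  have hcovW (i : J) : cov[fun ω => U ω i, W; P] = ∑ j, b j * S i (e j) := by
    rw [hW, covariance_fun_sum_right (fun j => (hcoord (e j)).memLp_two.const_mul _)
      (hcoord i).memLp_two]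
    simp_rw [covariance_const_mul_right, hcov]
  have hcovW' (i : ι) : cov[fun ω => U ω (e i), W; P] = S (e i) k := by
    rw [hcovW, ← congrFun (submatrix_mulVec_regressionCoeff hS he) i]
    simp [Matrix.mulVec, dotProduct, hb, mul_comm]
  have hcovR (i : J) : cov[fun ω => U ω i, R; P] = S i k - cov[fun ω => U ω i, W; P] := by
    rw [hR, covariance_fun_sub_right (hcoord i).memLp_two (hcoord k).memLp_two hWg.memLp_two, hcov]
  have hcovR' (i : ι) : cov[fun ω => U ω (e i), R; P] = 0 := by rw [hcovR, hcovW', sub_self]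
  have hWR : cov[W, R; P] = 0 := by
    rw [hW, covariance_fun_sum_left (fun j => (hcoord (e j)).memLp_two.const_mul _) hRg.memLp_two]
    simp_rw [covariance_const_mul_left, hcovR', mul_zero, Finset.sum_const_zero]
  have hvarW : Var[W; P] = explainedVariance S e k := by
    rw [← covariance_self hWg.aemeasurable]
    nth_rw 1 [hW]
    rw [covariance_fun_sum_left (fun j => (hcoord (e j)).memLp_two.const_mul _) hWg.memLp_two]
    simp_rw [covariance_const_mul_left, hcovW']
    rfl
  have hsymm (j : ι) : S k (e j) = S (e j) k := by simpa using hS.isHermitian.apply (e j) k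
  have hvarR : Var[R; P] = S k k - explainedVariance S e k := by
    rw [← covariance_self hRg.aemeasurable]
    nth_rw 1 [hR]
    rw [covariance_fun_sub_left (hcoord k).memLp_two hWg.memLp_two hRg.memLp_two, hWR, hcovR, hcovW]
    simp_rw [hsymm, sub_zero]
    rfl
  have hmeanW : ∫ ω, W ω ∂P = ∑ j, b j * μ (e j) := by
    rw [hW, integral_finsetSum _ fun j _ => (hcoord (e j)).integrable.const_mul _]
    simp_rw [integral_const_mul, hmean]
  have hmeanR : ∫ ω, R ω ∂P = μ k - ∑ j, b j * μ (e j) := by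
    rw [hR, integral_sub (hcoord k).integrable hWg.integrable, hmean, hmeanW]
  have hmeas : Measurable (regressionFun μ S e k) := by unfold regressionFun; fun_prop
  have hind : IndepFun (fun ω j => U ω (e j)) R P :=
    (hpair.indepFun_of_covariance_eval (X := fun j ω => U ω (e j)) (Y := fun _ ω => R ω)
      fun i _ => hcovR' i).comp measurable_id (measurable_pi_apply ())
  have hZm : AEMeasurable (fun ω j => U ω (e j)) P := by fun_prop
  have hRm := hRg.aemeasurable
  refine ⟨hmeas, ⟨by fun_prop, ?_⟩, ?_, ?_⟩
  · have hprod := (indepFun_iff_map_prod_eq_prod_map_map hZm hRm).1 hind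
    have hYeq : (fun ω => ((fun j => U ω (e j)), U ω k)) =
        (fun x : (ι → ℝ) × ℝ => (x.1, x.2 + ∑ j, b j * x.1 j)) ∘
          fun ω => ((fun j => U ω (e j)), R ω) := by
      ext ω <;> simp [hR, hW]
    have hφ : Measurable fun x : (ι → ℝ) × ℝ => (x.1, x.2 + ∑ j, b j * x.1 j) := by fun_prop
    rw [hYeq, ← AEMeasurable.map_map_of_aemeasurable hφ.aemeasurable (hZm.prodMk hRm), hprod,
      hRg.map_eq_gaussianReal, hmeanR, hvarR]
    have hPZ : IsProbabilityMeasure (P.map fun ω j => U ω (e j)) :=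
      Measure.isProbabilityMeasure_map hZm
    ext s hs
    rw [Measure.map_apply hφ hs, Measure.prod_apply (hφ hs), Measure.compProd_apply hs]
    congr 1 with z
    rw [normalKernel_apply, regressionFun, ← gaussianReal_map_add_const,
      Measure.map_apply (by fun_prop) (measurable_prodMk_left hs)]
    rfl
  · have hlaw : HasLaw W (gaussianReal (∑ j, b j * μ (e j)) (explainedVariance S e k).toNNReal) P :=
      ⟨hWg.aemeasurable, by rw [hWg.map_eq_gaussianReal, hmeanW, hvarW]⟩
    have := (gaussianReal_const_add hlaw (μ k - ∑ j, b j * μ (e j))).map_eq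
    rw [add_sub_cancel] at this
    exact this
  · rw [(hcoord k).map_eq_gaussianReal, hmean, ← covariance_self (hcoord k).aemeasurable, hcov,
      ← Real.toNNReal_add (explainedVariance_nonneg hS he)
        (sub_nonneg.2 (explainedVariance_lt hS he hk).le), add_sub_cancel]

theorem abs_regressionFun_sub_le (μ : EuclideanSpace ℝ J) (S : Matrix J J ℝ) (e : ι → J) (k : J)
    (x x' : ι → ℝ) : |regressionFun μ S e k x' - regressionFun μ S e k x| ≤
      (∑ j, |regressionCoeff S e k j|) * dist x' x := by
  rw [regressionFun, regressionFun, add_sub_add_left_eq_sub, ← Finset.sum_sub_distrib,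
    Finset.sum_mul]
  refine (Finset.abs_sum_le_sum_abs _ _).trans (Finset.sum_le_sum fun j _ => ?_)
  rw [← mul_sub, abs_mul, ← Real.dist_eq]
  exact mul_le_mul_of_nonneg_left (dist_le_pi_dist x' x j) (abs_nonneg _)

end

theorem IsNormalRegression.comp_measurableEquiv {Ω E F : Type*} [MeasurableSpace Ω]
    [MeasurableSpace E] [MeasurableSpace F] {P : Measure Ω} [IsProbabilityMeasure P] {Y : Ω → ℝ}
    {Z : Ω → E} {ℓ : E → ℝ} {m : ℝ} {r v : ℝ≥0} (h : IsNormalRegression P Y Z ℓ m r v)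
    (g : E ≃ᵐ F) : IsNormalRegression P Y (fun ω => g (Z ω)) (fun z => ℓ (g.symm z)) m r v where
  measurable_mean := h.measurable_mean.comp g.symm.measurable
  hasCondDistrib := h.hasCondDistrib.measurableEquiv_comp_right g
  map_mean := by simpa using h.map_mean
  map_target := h.map_target

/-! ### Jointly normal vectors -/

section

variable {p q : ℕ}

/-- The positions of the components of `(Y₁, …, Y_{i-1})` in `(X, Y)`. -/
def beforeIndex (p : ℕ) (i : Fin q) (j : Fin (i : ℕ)) : Fin p ⊕ Fin q :=
  .inr (Fin.castLE i.isLt.le j)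

/-- The positions of the components of `(X, Y₁, …, Y_{i-1})` in `(X, Y)`. -/
def withBeforeIndex (p : ℕ) (i : Fin q) : Fin p ⊕ Fin (i : ℕ) → Fin p ⊕ Fin q :=
  Sum.elim .inl (beforeIndex p i)

theorem beforeIndex_injective (i : Fin q) : (beforeIndex p i).Injective :=
  Sum.inr_injective.comp (Fin.castLE_injective _)

theorem beforeIndex_ne (i : Fin q) (j : Fin (i : ℕ)) : beforeIndex p i j ≠ .inr i := fun h => by
  have := congrArg Fin.val (Sum.inr_injective h)
  simp only [Fin.val_castLE] at this
  omega

theorem notMem_range_beforeIndex (i : Fin q) : .inr i ∉ Set.range (beforeIndex p i) := by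
  rintro ⟨j, hj⟩
  exact beforeIndex_ne i j hj

theorem withBeforeIndex_injective (i : Fin q) : (withBeforeIndex p i).Injective :=
  Sum.inl_injective.sumElim (beforeIndex_injective i) fun _ _ => Sum.inl_ne_inr

theorem notMem_range_withBeforeIndex (i : Fin q) : .inr i ∉ Set.range (withBeforeIndex p i) := by
  rintro ⟨j | j, hj⟩
  · exact Sum.inl_ne_inr hj
  · exact beforeIndex_ne i j hj

variable {Ω : Type*} [MeasurableSpace Ω] {P : Measure Ω} [IsProbabilityMeasure P]
  {X : Ω → Fin p → ℝ} {Y : Ω → Fin q → ℝ} {μ : EuclideanSpace ℝ (Fin p ⊕ Fin q)}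
  {S : Matrix (Fin p ⊕ Fin q) (Fin p ⊕ Fin q) ℝ}

theorem IsJointNormal.isNormalRegression_before (h : IsJointNormal P X Y μ S) (hS : S.PosDef)
    (i : Fin q) : IsNormalRegression P (component Y i) (before Y i)
      (regressionFun μ S (beforeIndex p i) (.inr i)) (μ (.inr i))
      (explainedVariance S (beforeIndex p i) (.inr i)).toNNReal
      (S (.inr i) (.inr i) - explainedVariance S (beforeIndex p i) (.inr i)).toNNReal :=
  isNormalRegression_of_hasLaw h hS (beforeIndex_injective i) (notMem_range_beforeIndex i)

theorem IsJointNormal.isNormalRegression_withBefore (h : IsJointNormal P X Y μ S) (hS : S.PosDef)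
    (i : Fin q) : IsNormalRegression P (component Y i) (withBefore X Y i)
      (fun z => regressionFun μ S (withBeforeIndex p i) (.inr i) (Sum.elim z.1 z.2)) (μ (.inr i))
      (explainedVariance S (withBeforeIndex p i) (.inr i)).toNNReal
      (S (.inr i) (.inr i) - explainedVariance S (withBeforeIndex p i) (.inr i)).toNNReal := by
  have := (isNormalRegression_of_hasLaw h hS (withBeforeIndex_injective i)
    (notMem_range_withBeforeIndex i)).comp_measurableEquiv
      (MeasurableEquiv.sumPiEquivProdPi fun _ => ℝ)
  have hsymm (z : (Fin p → ℝ) × (Fin (i : ℕ) → ℝ)) :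
      (MeasurableEquiv.sumPiEquivProdPi fun _ => ℝ).symm z = Sum.elim z.1 z.2 := by
    ext (j | j) <;> rfl
  simp_rw [hsymm] at this
  exact this

theorem IsJointNormal.nullSingletonClass_map_component (h : IsJointNormal P X Y μ S)
    (hS : S.PosDef) (i : Fin q) : NullSingletonClass (P.map (component Y i)) := by
  rw [(h.isNormalRegression_before hS i).map_target]
  refine nullSingletonClass_gaussianReal (ne_of_gt (add_pos_of_nonneg_of_pos zero_le ?_))
  exact Real.toNNReal_pos.2 (sub_pos.2 (explainedVariance_lt hS (beforeIndex_injective i)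
    (notMem_range_beforeIndex i)))

theorem dist_sumElim_le {ι κ : Type*} [Fintype ι] [Fintype κ] (x y : (ι → ℝ) × (κ → ℝ)) :
    dist (Sum.elim x.1 x.2) (Sum.elim y.1 y.2) ≤ dist x y := by
  refine (dist_pi_le_iff dist_nonneg).2 ?_
  rintro (j | j)
  · exact (dist_le_pi_dist x.1 y.1 j).trans (le_max_left _ _)
  · exact (dist_le_pi_dist x.2 y.2 j).trans (le_max_right _ _)

theorem tendsto_multivariateGaussian {J : Type*} [Fintype J] [DecidableEq J]
    {μ : ℕ → EuclideanSpace ℝ J} {μ' : EuclideanSpace ℝ J} {S : ℕ → Matrix J J ℝ}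
    {S' : Matrix J J ℝ} (hS : ∀ n, (S n).PosSemidef) (hS' : S'.PosSemidef)
    (hμ : Tendsto μ atTop (𝓝 μ')) (hconv : Tendsto S atTop (𝓝 S')) :
    Tendsto (β := ProbabilityMeasure (EuclideanSpace ℝ J))
      (fun n => ⟨multivariateGaussian (μ n) (S n), inferInstance⟩) atTop
      (𝓝 ⟨multivariateGaussian μ' S', inferInstance⟩) := by
  refine ProbabilityMeasure.tendsto_of_tendsto_charFun fun t => ?_
  simp only [ProbabilityMeasure.coe_mk, charFun_multivariateGaussian (hS _),
    charFun_multivariateGaussian hS']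
  have hquad : Tendsto (fun n => t ⬝ᵥ S n *ᵥ t) atTop (𝓝 (t ⬝ᵥ S' *ᵥ t)) :=
    tendsto_finsetSum _ fun i _ => (tendsto_finsetSum _ fun j _ =>
      ((hconv.apply_nhds i).apply_nhds j).mul_const _).const_mul _
  have hlin : Tendsto (fun n => inner ℝ t (μ n)) atTop (𝓝 (inner ℝ t μ')) :=
    tendsto_const_nhds.inner hμ
  exact (Complex.continuous_exp.tendsto _).comp
    ((((Complex.continuous_ofReal.tendsto _).comp hlin).mul_const _).sub
      (((Complex.continuous_ofReal.tendsto _).comp hquad).div_const _))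

theorem tendsto_chatterjeeXi {E : Type*} [MeasurableSpace E] {Ω : ℕ → Type*}
    [∀ n, MeasurableSpace (Ω n)] {P : ∀ n, Measure (Ω n)}
    [∀ n, IsProbabilityMeasure (P n)] {Ω' : Type*} [MeasurableSpace Ω'] {P' : Measure Ω'}
    [IsProbabilityMeasure P'] {Y : ∀ n, Ω n → ℝ} {Z : ∀ n, Ω n → E} {Y' : Ω' → ℝ} {Z' : Ω' → E}
    (hY : ∀ n, Measurable (Y n)) (hY' : Measurable Y')
    (hZ : ∀ n, Measurable (Z n)) (hZ' : Measurable Z')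
    {ℓ : ℕ → E → ℝ} {m : ℕ → ℝ} {r v : ℕ → ℝ≥0} {ℓ' : E → ℝ} {m' : ℝ} {r' v' : ℝ≥0}
    (h : ∀ n, IsNormalRegression (P n) (Y n) (Z n) (ℓ n) (m n) (r n) (v n))
    (h' : IsNormalRegression P' Y' Z' ℓ' m' r' v') (hv0 : ∀ n, v n ≠ 0) (hv0' : v' ≠ 0)
    (hr : Tendsto r atTop (𝓝 r')) (hv : Tendsto v atTop (𝓝 v')) :
    Tendsto (fun n => chatterjeeXi (P n) (Y n) (Z n)) atTop (𝓝 (chatterjeeXi P' Y' Z')) := by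
  rw [h'.chatterjeeXi_eq hY' hZ' hv0',
    funext fun n => (h n).chatterjeeXi_eq (hY n) (hZ n) (hv0 n)]
  exact Tendsto.comp (g := fun p : ℝ≥0 × ℝ≥0 => normalXi p.1 p.2) (f := fun n => (r n, v n))
    (continuousAt_normalXi hv0') (hr.prodMk_nhds hv)

theorem tendsto_dependenceT (hq : 1 ≤ q) {Ω : ℕ → Type*} [∀ n, MeasurableSpace (Ω n)]
    {P : ∀ n, Measure (Ω n)} {Ω' : Type*} [MeasurableSpace Ω'] {P' : Measure Ω'}
    [IsProbabilityMeasure P'] {X : ∀ n, Ω n → Fin p → ℝ} {Y : ∀ n, Ω n → Fin q → ℝ}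
    {X' : Ω' → Fin p → ℝ} {Y' : Ω' → Fin q → ℝ} (hY' : Measurable Y')
    (hW : ∀ i, Tendsto
      (fun n => chatterjeeXi (P n) (component (Y n) i) (withBefore (X n) (Y n) i)) atTop
      (𝓝 (chatterjeeXi P' (component Y' i) (withBefore X' Y' i))))
    (hB : ∀ i, Tendsto (fun n => chatterjeeXi (P n) (component (Y n) i) (before (Y n) i)) atTop
      (𝓝 (chatterjeeXi P' (component Y' i) (before Y' i)))) :
    Tendsto (fun n => dependenceT (P n) (Y n) (X n)) atTop (𝓝 (dependenceT P' Y' X')) := by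
  have hden : (∑ i : Fin q,
      if (i : ℕ) = 0 then 0 else chatterjeeXi P' (component Y' i) (before Y' i)) < (q : ℝ) := by
    have hlt : (∑ i : Fin q,
        if (i : ℕ) = 0 then 0 else chatterjeeXi P' (component Y' i) (before Y' i)) <
        ∑ _i : Fin q, (1 : ℝ) := by
      refine Finset.sum_lt_sum (fun i _ => ?_) ⟨⟨0, hq⟩, Finset.mem_univ _, by simp⟩
      split_ifs
      · exact zero_le_one
      · exact chatterjeeXi_le_one P' (measurable_component hY' i) (measurable_before hY' i)
    simpa using hlt
  have hnum : Tendsto (fun n => (q : ℝ) - ∑ i : Fin q,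
      chatterjeeXi (P n) (component (Y n) i) (withBefore (X n) (Y n) i)) atTop
      (𝓝 ((q : ℝ) - ∑ i : Fin q, chatterjeeXi P' (component Y' i) (withBefore X' Y' i))) :=
    (tendsto_finsetSum _ fun i _ => hW i).const_sub _
  have hdenom : Tendsto (fun n => (q : ℝ) - ∑ i : Fin q,
      if (i : ℕ) = 0 then 0 else chatterjeeXi (P n) (component (Y n) i) (before (Y n) i)) atTop
      (𝓝 ((q : ℝ) - ∑ i : Fin q,
        if (i : ℕ) = 0 then 0 else chatterjeeXi P' (component Y' i) (before Y' i))) := by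
    refine (tendsto_finsetSum _ fun i _ => ?_).const_sub _
    split_ifs
    · exact tendsto_const_nhds
    · exact hB i
  exact (hnum.div hdenom (sub_pos.2 hden).ne').const_sub 1

theorem IsJointNormal.tendstoInDistribution {Ω : ℕ → Type*} [∀ n, MeasurableSpace (Ω n)]
    {P : ∀ n, Measure (Ω n)} [∀ n, IsProbabilityMeasure (P n)]
    {Ω' : Type*} [MeasurableSpace Ω'] {P' : Measure Ω'} [IsProbabilityMeasure P']
    {X : ∀ n, Ω n → Fin p → ℝ} {Y : ∀ n, Ω n → Fin q → ℝ}
    {X' : Ω' → Fin p → ℝ} {Y' : Ω' → Fin q → ℝ}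
    {μ : ℕ → EuclideanSpace ℝ (Fin p ⊕ Fin q)} {μ' : EuclideanSpace ℝ (Fin p ⊕ Fin q)}
    {S : ℕ → Matrix (Fin p ⊕ Fin q) (Fin p ⊕ Fin q) ℝ}
    {S' : Matrix (Fin p ⊕ Fin q) (Fin p ⊕ Fin q) ℝ}
    (h : ∀ n, IsJointNormal (P n) (X n) (Y n) (μ n) (S n)) (h' : IsJointNormal P' X' Y' μ' S')
    (hS : ∀ n, (S n).PosSemidef) (hS' : S'.PosSemidef)
    (hμ : Tendsto μ atTop (𝓝 μ')) (hconv : Tendsto S atTop (𝓝 S')) :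
    TendstoInDistribution (fun n ω => (X n ω, Y n ω)) atTop (fun ω => (X' ω, Y' ω)) P P' := by
  have hlaw : TendstoInDistribution
      (fun n ω => (WithLp.toLp 2 (Sum.elim (X n ω) (Y n ω)) : EuclideanSpace ℝ (Fin p ⊕ Fin q)))
      atTop (fun ω => WithLp.toLp 2 (Sum.elim (X' ω) (Y' ω))) P P' := by
    refine ⟨fun n => HasLaw.aemeasurable (h n), HasLaw.aemeasurable h', ?_⟩
    exact ((tendsto_multivariateGaussian hS hS' hμ hconv).congr fun n =>
      Subtype.ext (HasLaw.map_eq (h n)).symm).mono_right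
        (le_of_eq (congrArg 𝓝 (Subtype.ext (HasLaw.map_eq h').symm)))
  exact hlaw.continuous_comp (g := fun u : EuclideanSpace ℝ (Fin p ⊕ Fin q) =>
    (fun i => u (.inl i), fun j => u (.inr j))) (by fun_prop)

theorem IsJointNormal.cdf_genInverse (h : IsJointNormal P X Y μ S) (hS : S.PosDef)
    (hY : Measurable Y) (i : Fin q) {t : ℝ} (ht : t ∈ Set.Ioo (0 : ℝ) 1) :
    cdf (P.map (component Y i)) (genInverse (cdf (P.map (component Y i))) t) = t := by
  have := h.nullSingletonClass_map_component hS i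
  have := Measure.isProbabilityMeasure_map (μ := P) (measurable_component hY i).aemeasurable
  exact _root_.cdf_genInverse _ ht

end

theorem mainTheorem12 {p q : ℕ} (hp : 1 ≤ p) (hq : 1 ≤ q)
    {Ω : ℕ → Type*} [∀ n, MeasurableSpace (Ω n)] (P : ∀ n, Measure (Ω n))
    [∀ n, IsProbabilityMeasure (P n)]
    {Ω' : Type*} [MeasurableSpace Ω'] (P' : Measure Ω') [IsProbabilityMeasure P']
    (X : ∀ n, Ω n → Fin p → ℝ) (Y : ∀ n, Ω n → Fin q → ℝ)
    (X' : Ω' → Fin p → ℝ) (Y' : Ω' → Fin q → ℝ)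
    (hX : ∀ n, Measurable (X n)) (hY : ∀ n, Measurable (Y n))
    (hX' : Measurable X') (hY' : Measurable Y')
    (μ : ℕ → EuclideanSpace ℝ (Fin p ⊕ Fin q)) (μ' : EuclideanSpace ℝ (Fin p ⊕ Fin q))
    (S : ℕ → Matrix (Fin p ⊕ Fin q) (Fin p ⊕ Fin q) ℝ)
    (S' : Matrix (Fin p ⊕ Fin q) (Fin p ⊕ Fin q) ℝ)
    (hS : ∀ n, (S n).PosDef) (hS' : S'.PosDef)
    (hnormal : ∀ n, IsJointNormal (P n) (X n) (Y n) (μ n) (S n))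
    (hnormal' : IsJointNormal P' X' Y' μ' S')
    (hconv : Tendsto S atTop (𝓝 S')) :
    -- joint convergence in distribution and convergence of the Markov products
    (Tendsto μ atTop (𝓝 μ') →
      TendstoInDistribution (fun n ω => (X n ω, Y n ω)) atTop (fun ω => (X' ω, Y' ω)) P P' ∧
      (∀ i : Fin q,
        Tendsto (fun n => markovProduct (P n) (component (Y n) i) (withBefore (X n) (Y n) i)
            (measurable_withBefore (hX n) (hY n) i)) atTop
          (𝓝 (markovProduct P' (component Y' i) (withBefore X' Y' i)
            (measurable_withBefore hX' hY' i)))) ∧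
      (∀ i : Fin q, 0 < (i : ℕ) →
        Tendsto (fun n => markovProduct (P n) (component (Y n) i) (before (Y n) i)
            (measurable_before (hY n) i)) atTop
          (𝓝 (markovProduct P' (component Y' i) (before Y' i)
            (measurable_before hY' i))))) ∧
    -- asymptotic equicontinuity of the conditional distributions
    (∀ (i : Fin q) (V : Set ((Fin p → ℝ) × (Fin (i : ℕ) → ℝ))), IsOpen V →
      P' (withBefore X' Y' i ⁻¹' V) = 1 →
      CondAsympEquicontinuousOn P (fun n => component (Y n) i)
        (fun n => withBefore (X n) (Y n) i) V) ∧
    (∀ (i : Fin q) (U : Set (Fin (i : ℕ) → ℝ)), 0 < (i : ℕ) → IsOpen U →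
      P' (before Y' i ⁻¹' U) = 1 →
      CondAsympEquicontinuousOn P (fun n => component (Y n) i)
        (fun n => before (Y n) i) U) ∧
    -- range convergence of the marginal distribution functions
    (∀ i : Fin q, ∀ᵐ t ∂(volume.restrict (Set.Ioo (0 : ℝ) 1)),
      Tendsto (fun n => cdf ((P n).map (component (Y n) i))
          (genInverse (cdf ((P n).map (component (Y n) i))) t)) atTop
        (𝓝 (cdf (P'.map (component Y' i)) (genInverse (cdf (P'.map (component Y' i))) t)))) ∧
    -- continuity of the dependence measure
    Tendsto (fun n => dependenceT (P n) (Y n) (X n)) atTop (𝓝 (dependenceT P' Y' X')) := by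
  have hSkk (i : Fin q) : Tendsto (fun n => S n (.inr i) (.inr i)) atTop
      (𝓝 (S' (.inr i) (.inr i))) := (hconv.apply_nhds _).apply_nhds _
  have hrB (i : Fin q) := tendsto_real_toNNReal
    (tendsto_explainedVariance (k := .inr i) hS' (beforeIndex_injective (p := p) i) hconv)
  have hrW (i : Fin q) := tendsto_real_toNNReal
    (tendsto_explainedVariance (k := .inr i) hS' (withBeforeIndex_injective (p := p) i) hconv)
  have hvB (i : Fin q) := tendsto_real_toNNReal ((hSkk i).sub
    (tendsto_explainedVariance (k := .inr i) hS' (beforeIndex_injective (p := p) i) hconv))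
  have hvW (i : Fin q) := tendsto_real_toNNReal ((hSkk i).sub
    (tendsto_explainedVariance (k := .inr i) hS' (withBeforeIndex_injective (p := p) i) hconv))
  have hposB {T : Matrix (Fin p ⊕ Fin q) (Fin p ⊕ Fin q) ℝ} (hT : T.PosDef) (i : Fin q) :
      (T (.inr i) (.inr i) - explainedVariance T (beforeIndex p i) (.inr i)).toNNReal ≠ 0 :=
    (Real.toNNReal_pos.2 (sub_pos.2 (explainedVariance_lt hT (beforeIndex_injective i)
      (notMem_range_beforeIndex i)))).ne'
  have hposW {T : Matrix (Fin p ⊕ Fin q) (Fin p ⊕ Fin q) ℝ} (hT : T.PosDef) (i : Fin q) :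
      (T (.inr i) (.inr i) - explainedVariance T (withBeforeIndex p i) (.inr i)).toNNReal ≠ 0 :=
    (Real.toNNReal_pos.2 (sub_pos.2 (explainedVariance_lt hT (withBeforeIndex_injective i)
      (notMem_range_withBeforeIndex i)))).ne'
  refine ⟨fun hμ => ⟨?_, fun i => ?_, fun i _ => ?_⟩, fun i V _ _ => ?_, fun i U _ _ _ => ?_,
    fun i => ?_, ?_⟩
  · exact IsJointNormal.tendstoInDistribution hnormal hnormal' (fun n => (hS n).posSemidef)
      hS'.posSemidef hμ hconv
  · exact tendsto_markovProduct _ _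
      (fun n => (hnormal n).isNormalRegression_withBefore (hS n) i)
      (hnormal'.isNormalRegression_withBefore hS' i)
      (((PiLp.continuous_apply 2 _ (Sum.inr i)).tendsto _).comp hμ) (hrW i) (hvW i)
  · exact tendsto_markovProduct _ _
      (fun n => (hnormal n).isNormalRegression_before (hS n) i)
      (hnormal'.isNormalRegression_before hS' i)
      (((PiLp.continuous_apply 2 _ (Sum.inr i)).tendsto _).comp hμ) (hrB i) (hvB i)
  · have hb := tendsto_finsetSum Finset.univ fun j _ => ((tendsto_regressionCoeff (k := .inr i) hS'
      (withBeforeIndex_injective (p := p) i) hconv).apply_nhds j).abs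
    refine condAsympEquicontinuousOn_of_isNormalRegression
      (K := ∑ j, |regressionCoeff S' (withBeforeIndex p i) (.inr i) j| + 1)
      (fun n => (hnormal n).isNormalRegression_withBefore (hS n) i) (hvW i) (hposW hS' i)
      ((hb.eventually_lt_const (lt_add_one _)).mono fun n hn x x' => ?_) V
    exact (abs_regressionFun_sub_le _ _ _ _ _ _).trans
      (mul_le_mul hn.le (dist_sumElim_le x' x) dist_nonneg
        ((Finset.sum_nonneg fun j _ => abs_nonneg _).trans hn.le))
  · have hb := tendsto_finsetSum Finset.univ fun j _ => ((tendsto_regressionCoeff (k := .inr i) hS'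
      (beforeIndex_injective (p := p) i) hconv).apply_nhds j).abs
    refine condAsympEquicontinuousOn_of_isNormalRegression
      (K := ∑ j, |regressionCoeff S' (beforeIndex p i) (.inr i) j| + 1)
      (fun n => (hnormal n).isNormalRegression_before (hS n) i) (hvB i) (hposB hS' i)
      ((hb.eventually_lt_const (lt_add_one _)).mono fun n hn x x' => ?_) U
    exact (abs_regressionFun_sub_le _ _ _ _ _ _).trans
      (mul_le_mul_of_nonneg_right hn.le dist_nonneg)
  · refine (ae_restrict_iff' measurableSet_Ioo).2 (.of_forall fun t ht => ?_)
    rw [hnormal'.cdf_genInverse hS' hY' i ht,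
      funext fun n => (hnormal n).cdf_genInverse (hS n) (hY n) i ht]
    exact tendsto_const_nhds
  · refine tendsto_dependenceT hq hY' (fun i => ?_) fun i => ?_
    · exact tendsto_chatterjeeXi (fun n => measurable_component (hY n) i)
        (measurable_component hY' i) (fun n => measurable_withBefore (hX n) (hY n) i)
        (measurable_withBefore hX' hY' i)
        (fun n => (hnormal n).isNormalRegression_withBefore (hS n) i)
        (hnormal'.isNormalRegression_withBefore hS' i) (fun n => hposW (hS n) i) (hposW hS' i)
        (hrW i) (hvW i)
    · exact tendsto_chatterjeeXi (fun n => measurable_component (hY n) i)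
        (measurable_component hY' i) (fun n => measurable_before (hY n) i)
        (measurable_before hY' i)
        (fun n => (hnormal n).isNormalRegression_before (hS n) i)
        (hnormal'.isNormalRegression_before hS' i) (fun n => hposB (hS n) i) (hposB hS' i)
        (hrB i) (hvB i)
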